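/- A *tournament limit* is a measurable function $W:[0,1]^2\to[0,1]$ such that $W(x,y)+W(y,x)=1$ for all $(x,y)\in[0,1]^2$. For $\ell\ge 3$ the density of the directed cycle $C_\ell$ in $W$ is \[t(C_\ell,W)=\int_{[0,1]^\ell}W(x_1,x_2)W(x_2,x_3)\cdots W(x_{\ell-1},x_\ell)W(x_\ell,x_1)\,\mathrm{d}x_1\cdots\mathrm{d}x_\ell .\] Let $g:[0,1/8]\to[0,1]$ be the function determined by $g(0)=0$ and \[g\left(\tfrac18\left(\lfloor z^{-1}\rfloor z^3+(1-\lfloor z^{-1}\rfloor z)^3\right)\right)=\tfrac1{16}\left(\lfloor z^{-1}\rfloor z^4+(1-\lfloor z^{-1}\rfloor z)^4\right)\qquad\text{for } z\in(0,1].\] Then for every tournament limit $W$ with $t(C_3,W)\ge 1/72$, it holds that $t(C_3,W)\le 1/8$ (so that $g(t(C_3,W))$ is defined) and \[t(C_4,W)\ge g(t(C_3,W)).\] -/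

import Mathlib

open MeasureTheory

/-- A tournament limit: a (Lebesgue) measurable function `W : [0,1]² → [0,1]` such that
`W(x,y) + W(y,x) = 1` for all `(x,y)`.  Lebesgue measurability is expressed as a.e.-measurability
with respect to Lebesgue measure, so Borel measurable functions are included. -/
structure TournamentLimit where
  /-- the underlying function -/
  toFun : unitInterval → unitInterval → ℝ
  aemeasurable' : AEMeasurable (fun p : unitInterval × unitInterval => toFun p.1 p.2) volume
  mem_Icc' : ∀ x y, toFun x y ∈ Set.Icc (0 : ℝ) 1
  add_swap' : ∀ x y, toFun x y + toFun y x = 1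

/-- The density `t(C_ℓ, W)` of the directed cycle of length `ℓ` in `W`:
the integral of `W(x₁,x₂) W(x₂,x₃) ⋯ W(x_ℓ,x₁)` over `[0,1]^ℓ`. The addition `i + 1` in `Fin ℓ`
is cyclic. -/
noncomputable def TournamentLimit.cycleDensity (W : TournamentLimit) (ℓ : ℕ) [NeZero ℓ] : ℝ :=
  ∫ x : Fin ℓ → unitInterval, ∏ i : Fin ℓ, W.toFun (x i) (x (i + 1))

/-- `(⌊z⁻¹⌋ z³ + (1 - ⌊z⁻¹⌋ z)³) / 8` -/
noncomputable def blowupC3 (z : ℝ) : ℝ :=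
  1 / 8 * ((⌊z⁻¹⌋₊ : ℝ) * z ^ 3 + (1 - (⌊z⁻¹⌋₊ : ℝ) * z) ^ 3)

/-- `(⌊z⁻¹⌋ z⁴ + (1 - ⌊z⁻¹⌋ z)⁴) / 16` -/
noncomputable def blowupC4 (z : ℝ) : ℝ :=
  1 / 16 * ((⌊z⁻¹⌋₊ : ℝ) * z ^ 4 + (1 - (⌊z⁻¹⌋₊ : ℝ) * z) ^ 4)

open Classical in
/-- The function `g : [0,1/8] → [0,1]` with `g 0 = 0` and `g (blowupC3 z) = blowupC4 z` for
`z ∈ (0,1]`, extended by `0` outside `[0,1/8]`. See `g_zero`, `g_blowupC3` for the defining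
equations and `exists_blowupC3_eq` for the fact that they determine `g` on `[0,1/8]`. -/
noncomputable def g (s : ℝ) : ℝ :=
  if h : ∃ z ∈ Set.Ioc (0 : ℝ) 1, blowupC3 z = s then blowupC4 h.choose else 0

theorem blowup_floor_bounds {z : ℝ} (hz : z ∈ Set.Ioc (0 : ℝ) 1) :
    1 ≤ ⌊z⁻¹⌋₊ ∧ (⌊z⁻¹⌋₊ : ℝ) * z ≤ 1 ∧ 1 < ((⌊z⁻¹⌋₊ : ℝ) + 1) * z := by
  obtain ⟨h0, h1⟩ := hz
  have hi : 1 ≤ z⁻¹ := (one_le_inv₀ h0).2 h1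
  refine ⟨Nat.le_floor (by simpa using hi), ?_, ?_⟩
  · have := Nat.floor_le (zero_le_one.trans hi)
    calc (⌊z⁻¹⌋₊ : ℝ) * z ≤ z⁻¹ * z := by gcongr
      _ = 1 := inv_mul_cancel₀ h0.ne'
  · have := Nat.lt_floor_add_one z⁻¹
    calc (1 : ℝ) = z⁻¹ * z := (inv_mul_cancel₀ h0.ne').symm
      _ < ((⌊z⁻¹⌋₊ : ℝ) + 1) * z := by gcongr

theorem blowup_poly_strictMono {k w z : ℝ} (hk : 1 ≤ k) (hw : 1 ≤ (k + 1) * w) (hwz : w < z)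
    (hz : k * z ≤ 1) : k * w ^ 3 + (1 - k * w) ^ 3 < k * z ^ 3 + (1 - k * z) ^ 3 := by
  have hw0 : 0 < w := by
    by_contra h
    nlinarith
  have hb : 0 ≤ 1 - k * z := by linarith
  have hba : 1 - k * z < 1 - k * w := by nlinarith
  have haw : 1 - k * w ≤ w := by linarith
  have key : k * z ^ 3 + (1 - k * z) ^ 3 - (k * w ^ 3 + (1 - k * w) ^ 3) =
      k * (z - w) * ((z ^ 2 + z * w + w ^ 2) -
        ((1 - k * w) ^ 2 + (1 - k * w) * (1 - k * z) + (1 - k * z) ^ 2)) := by ring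
  have h2 : (1 - k * w) ^ 2 + (1 - k * w) * (1 - k * z) + (1 - k * z) ^ 2 <
      z ^ 2 + z * w + w ^ 2 := by
    have e1 : (1 - k * w) ^ 2 ≤ w ^ 2 := by gcongr; linarith
    have e2 : (1 - k * w) * (1 - k * z) ≤ w * z := by gcongr; linarith
    have e3 : (1 - k * z) ^ 2 < z ^ 2 := by gcongr; linarith
    linarith
  have h3 := mul_pos (mul_pos (by linarith : 0 < k) (sub_pos.2 hwz)) (sub_pos.2 h2)
  linarith

theorem blowupC3_strictMonoOn : StrictMonoOn blowupC3 (Set.Ioc (0 : ℝ) 1) := by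
  intro w hw z hz hwz
  obtain ⟨hk1, hk2, hk3⟩ := blowup_floor_bounds hw
  obtain ⟨hl1, hl2, hl3⟩ := blowup_floor_bounds hz
  have hmono : ⌊z⁻¹⌋₊ ≤ ⌊w⁻¹⌋₊ := Nat.floor_mono (inv_anti₀ hw.1 hwz.le)
  have hz0 := hz.1
  unfold blowupC3
  generalize ⌊z⁻¹⌋₊ = l at *
  generalize ⌊w⁻¹⌋₊ = k at *
  have hk1' : (1 : ℝ) ≤ k := by exact_mod_cast hk1
  have hl1' : (1 : ℝ) ≤ l := by exact_mod_cast hl1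
  rcases hmono.eq_or_lt with rfl | hlt
  · linarith [blowup_poly_strictMono hk1' hk3.le hwz hl2]
  · have hlt' : (l : ℝ) + 1 ≤ k := by exact_mod_cast hlt
    have hl0 : (0 : ℝ) < l + 1 := by linarith
    have hk0 : (0 : ℝ) < k := by linarith
    -- both values are separated by `1 / (l + 1) ^ 2`
    have hA : (k : ℝ) * w ^ 3 + (1 - k * w) ^ 3 ≤ (k : ℝ)⁻¹ ^ 2 := by
      have hwk : w ≤ (k : ℝ)⁻¹ := by
        rw [inv_eq_one_div, le_div_iff₀ hk0]; linarith
      have e : (k : ℝ) * (k : ℝ)⁻¹ ^ 3 + (1 - k * (k : ℝ)⁻¹) ^ 3 = (k : ℝ)⁻¹ ^ 2 := by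
        field_simp; ring
      rcases hwk.eq_or_lt with h | h
      · rw [h, e]
      · have := blowup_poly_strictMono hk1' hk3.le h (mul_inv_cancel₀ hk0.ne').le
        linarith
    have hB : ((l : ℝ) + 1)⁻¹ ^ 2 < (l : ℝ) * z ^ 3 + (1 - l * z) ^ 3 := by
      have hzl : ((l : ℝ) + 1)⁻¹ < z := by
        rw [inv_eq_one_div, div_lt_iff₀ hl0]; linarith
      have e : (l : ℝ) * ((l : ℝ) + 1)⁻¹ ^ 3 + (1 - l * ((l : ℝ) + 1)⁻¹) ^ 3 =
          ((l : ℝ) + 1)⁻¹ ^ 2 := by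
        field_simp; ring
      have := blowup_poly_strictMono hl1' (mul_inv_cancel₀ hl0.ne').ge hzl hl2
      linarith
    have hC : (k : ℝ)⁻¹ ^ 2 ≤ ((l : ℝ) + 1)⁻¹ ^ 2 := by gcongr
    linarith

/-- The defining equation of `g` on `(0,1/8]`. -/
theorem g_blowupC3 {z : ℝ} (hz : z ∈ Set.Ioc (0 : ℝ) 1) : g (blowupC3 z) = blowupC4 z := by
  have h : ∃ w ∈ Set.Ioc (0 : ℝ) 1, blowupC3 w = blowupC3 z := ⟨z, hz, rfl⟩
  have := blowupC3_strictMonoOn.injOn h.choose_spec.1 hz h.choose_spec.2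
  rw [g, dif_pos h, this]

theorem g_zero : g 0 = 0 := by
  refine dif_neg ?_
  rintro ⟨z, hz, h⟩
  obtain ⟨h1, h2, -⟩ := blowup_floor_bounds hz
  have h1' : (1 : ℝ) ≤ (⌊z⁻¹⌋₊ : ℝ) := by exact_mod_cast h1
  have hz0 := hz.1
  have e1 : 0 < (⌊z⁻¹⌋₊ : ℝ) * z ^ 3 := by positivity
  have e2 : 0 ≤ (1 - (⌊z⁻¹⌋₊ : ℝ) * z) ^ 3 := pow_nonneg (by linarith) 3
  unfold blowupC3 at h
  linarith

/-- Every point of `(0,1/8]` is of the form `blowupC3 z` with `z ∈ (0,1]`. -/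
theorem exists_blowupC3_eq {s : ℝ} (hs : s ∈ Set.Ioc (0 : ℝ) (1 / 8)) :
    ∃ z ∈ Set.Ioc (0 : ℝ) 1, blowupC3 z = s := by
  obtain ⟨hs0, hs1⟩ := hs
  -- choose `k` with `1 / (k + 1) ^ 2 < 8 s ≤ 1 / k ^ 2`
  have hr0 : 0 < √(8 * s) := Real.sqrt_pos.2 (by linarith)
  have hr1 : √(8 * s) ≤ 1 := Real.sqrt_le_one.2 (by linarith)
  have hr2 : √(8 * s) ^ 2 = 8 * s := Real.sq_sqrt (by linarith)
  obtain ⟨hk1, hk2, hk3⟩ := blowup_floor_bounds ⟨hr0, hr1⟩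
  generalize ⌊(√(8 * s))⁻¹⌋₊ = k at *
  generalize √(8 * s) = r at *
  have hk1' : (1 : ℝ) ≤ k := by exact_mod_cast hk1
  have hk0 : (0 : ℝ) < k := by linarith
  have hl0 : (0 : ℝ) < k + 1 := by linarith
  have ha : ((k : ℝ) + 1)⁻¹ < r := by rw [inv_eq_one_div, div_lt_iff₀ hl0]; linarith
  have hb : r ≤ (k : ℝ)⁻¹ := by rw [inv_eq_one_div, le_div_iff₀ hk0]; linarith
  have hivt := intermediate_value_Ioc (f := fun z : ℝ => (k : ℝ) * z ^ 3 + (1 - k * z) ^ 3)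
    (a := ((k : ℝ) + 1)⁻¹) (b := (k : ℝ)⁻¹) (ha.le.trans hb) (by fun_prop)
  have ea : (k : ℝ) * ((k : ℝ) + 1)⁻¹ ^ 3 + (1 - k * ((k : ℝ) + 1)⁻¹) ^ 3 =
      ((k : ℝ) + 1)⁻¹ ^ 2 := by
    field_simp; ring
  have eb : (k : ℝ) * (k : ℝ)⁻¹ ^ 3 + (1 - k * (k : ℝ)⁻¹) ^ 3 = (k : ℝ)⁻¹ ^ 2 := by
    field_simp; ring
  have hmem : 8 * s ∈ Set.Ioc (((k : ℝ) + 1)⁻¹ ^ 2) ((k : ℝ)⁻¹ ^ 2) := by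
    rw [← hr2]
    constructor <;> gcongr
  obtain ⟨z, ⟨hz1, hz2⟩, hz3⟩ := hivt (by simpa only [ea, eb] using hmem)
  have hz0 : 0 < z := lt_trans (by positivity) hz1
  have hfl : ⌊z⁻¹⌋₊ = k := by
    rw [Nat.floor_eq_iff (by positivity)]
    exact ⟨(le_inv_comm₀ hk0 hz0).2 hz2, (inv_lt_comm₀ hz0 hl0).2 hz1⟩
  refine ⟨z, ⟨hz0, hz2.trans (inv_le_one_of_one_le₀ hk1')⟩, ?_⟩
  have hz3' : (k : ℝ) * z ^ 3 + (1 - k * z) ^ 3 = 8 * s := hz3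
  rw [blowupC3, hfl, hz3']
  ring

/-! Scale a positive tournament matrix A of size n by 2/n. The trace becomes 1, and 8 t(C_3), 16
t(C_4) become the sums of Re λ³ and Re λ⁴ over the eigenvalues λ. Real parts are nonnegative because
A + Aᵀ is positive semidefinite; they sum to 1; and a nonreal λ has Re λ ≤ 1/3, because λ, its
conjugate and the Perron root share the total 1 (`Matrix.isTournamentSpectrum_roots_charpoly`).

For real spectra the problem is to minimise the power sum p₄ of nonnegative numbers with p₁ = 1 and
p₃ given. For p₃ ≥ 1/9 the optimum is z, 1 - z or z, z, 1 - 2z (`PowerSum.two_part_bound`,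
`PowerSum.three_part_bound`). Passing from a complex spectrum to its real parts does not lower p₃
and does not raise p₄ - L p₃ when L ≥ 2 Re λ for all nonreal λ. For a suitable L the chords of the
extremal curve have slope at least L, so the bound for the real parts carries back.

Finally, the densities of any W are limits of those of positive matrices
(`TournamentLimit.mem_closure_matrixProfile`), by L¹-continuity of cycle densities. -/

namespace PowerSum

/-! ### Power sums of nonnegative reals -/

theorem sum_nonneg {s : Multiset ℝ} (hs : ∀ a ∈ s, 0 ≤ a) (k : ℕ) :
    0 ≤ (s.map (· ^ k)).sum :=
  Multiset.sum_nonneg fun x hx => by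
    obtain ⟨a, ha, rfl⟩ := Multiset.mem_map.1 hx
    exact pow_nonneg (hs a ha) k

theorem sum_cube_le {s : Multiset ℝ} (hs : ∀ a ∈ s, 0 ≤ a) :
    (s.map (· ^ 3)).sum ≤ s.sum ^ 3 := by
  induction s using Multiset.induction_on with
  | empty => simp
  | cons t s ih =>
    have ht : 0 ≤ t := hs t (Multiset.mem_cons_self t s)
    have hs' : ∀ a ∈ s, 0 ≤ a := fun a ha => hs a (Multiset.mem_cons_of_mem ha)
    have hq : 0 ≤ s.sum := Multiset.sum_nonneg hs'
    have := ih hs'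
    simp only [Multiset.map_cons, Multiset.sum_cons]
    nlinarith [mul_nonneg ht hq, mul_nonneg (mul_nonneg ht hq) (add_nonneg ht hq)]

/-- The relation between the first, third and fourth power sums of nonnegative reals that is
sharp for two variables. -/
theorem two_part_bound {s : Multiset ℝ} (hs : ∀ a ∈ s, 0 ≤ a) :
    2 * (s.map (· ^ 3)).sum ^ 2 + 8 * (s.map (· ^ 3)).sum * s.sum ^ 3 ≤
      9 * (s.map (· ^ 4)).sum * s.sum ^ 2 + s.sum ^ 6 := by
  induction s using Multiset.induction_on with
  | empty => simp
  | cons t s ih =>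
    have ht : 0 ≤ t := hs t (Multiset.mem_cons_self t s)
    have hs' : ∀ a ∈ s, 0 ≤ a := fun a ha => hs a (Multiset.mem_cons_of_mem ha)
    have hq : 0 ≤ s.sum := Multiset.sum_nonneg hs'
    have h3 := sum_cube_le hs'
    have h30 := sum_nonneg hs' 3
    have h40 := sum_nonneg hs' 4
    have ih := ih hs'
    simp only [Multiset.map_cons, Multiset.sum_cons]
    generalize (s.map (· ^ 3)).sum = u at *
    generalize (s.map (· ^ 4)).sum = v at *
    generalize s.sum = q at *
    rcases hq.eq_or_lt with rfl | hq
    · have : u = 0 := by nlinarith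
      subst this
      nlinarith [mul_nonneg h40 (sq_nonneg t)]
    -- Up to the factor q², the defect of `t ::ₘ s` is (t + q)² times the defect of `s`, plus a term
    -- that is nonnegative because u ≤ q³.
    · have key : q ^ 2 * (9 * (t ^ 4 + v) * (t + q) ^ 2 + (t + q) ^ 6 -
          (2 * (t ^ 3 + u) ^ 2 + 8 * (t ^ 3 + u) * (t + q) ^ 3)) =
          (9 * v * q ^ 2 + q ^ 6 - (2 * u ^ 2 + 8 * u * q ^ 3)) * (t + q) ^ 2 +
          (q ^ 3 - u) * (t * (4 * q + 2 * t) * (q ^ 3 - u) + 12 * q ^ 2 * t ^ 2 * (q + t)) := by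
        ring
      have h1 : 0 ≤ (9 * v * q ^ 2 + q ^ 6 - (2 * u ^ 2 + 8 * u * q ^ 3)) * (t + q) ^ 2 :=
        mul_nonneg (by linarith) (sq_nonneg _)
      have h2 : 0 ≤ q ^ 3 - u := by linarith
      have h4 : 0 ≤ (q ^ 3 - u) *
          (t * (4 * q + 2 * t) * (q ^ 3 - u) + 12 * q ^ 2 * t ^ 2 * (q + t)) := by positivity
      have := nonneg_of_mul_nonneg_right (key ▸ add_nonneg h1 h4) (by positivity : 0 < q ^ 2)
      linarith

/-- Third power sum of the three numbers `z, z, 1 - 2z`. -/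
def cubeSum (z : ℝ) : ℝ := 2 * z ^ 3 + (1 - 2 * z) ^ 3

/-- Fourth power sum of the three numbers `z, z, 1 - 2z`. -/
def quarticSum (z : ℝ) : ℝ := 2 * z ^ 4 + (1 - 2 * z) ^ 4

/-- The cube sum is the average of a² with weights a, so the largest member serves as x. -/
theorem exists_sum_cube_le_sq {s : Multiset ℝ} (hs : ∀ a ∈ s, 0 ≤ a) (h1 : s.sum = 1) :
    ∃ x ∈ s, (s.map (· ^ 3)).sum ≤ x ^ 2 := by
  have hne : s.toFinset.Nonempty := by
    rw [Multiset.toFinset_nonempty]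
    rintro rfl
    simp at h1
  obtain ⟨x, hx, hmax⟩ := s.toFinset.exists_max_image id hne
  refine ⟨x, Multiset.mem_toFinset.1 hx, ?_⟩
  calc (s.map (· ^ 3)).sum ≤ (s.map fun a => x ^ 2 * a).sum := by
        refine Multiset.sum_map_le_sum_map _ _ fun a ha => ?_
        have h0 := hs a ha
        have := hmax a (Multiset.mem_toFinset.2 ha)
        simp only [id] at this
        have : a ^ 2 ≤ x ^ 2 := by gcongr
        nlinarith
    _ = x ^ 2 := by rw [Multiset.sum_map_mul_left, Multiset.map_id', h1, mul_one]

/-- Keep the largest part x and apply the two-variable bound to the rest: p₄ is at least its formal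
value for three parts including x with the same p₁ and p₃. For three parts, p₃ determines e₂ - e₃,
and p₄ = 1 - 4(e₂ - e₃) + 2e₂². It remains to bound e₂ below by 2z - 3z², its value at z, z, 1 - 2z.
-/
theorem three_part_bound {s : Multiset ℝ} (hs : ∀ a ∈ s, 0 ≤ a) (h1 : s.sum = 1) {z : ℝ}
    (hz : 1 / 3 ≤ z) (hz' : z ≤ 1 / 2) (h3 : (s.map (· ^ 3)).sum = cubeSum z) :
    quarticSum z ≤ (s.map (· ^ 4)).sum := by
  obtain ⟨x, hx, hx3⟩ := exists_sum_cube_le_sq hs h1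
  have hx0 := hs x hx
  obtain ⟨r, rfl⟩ := Multiset.exists_cons_of_mem hx
  have hr : ∀ a ∈ r, 0 ≤ a := fun a ha => hs a (Multiset.mem_cons_of_mem ha)
  have hb := two_part_bound hr
  have hq := Multiset.sum_nonneg hr
  have h40 := sum_nonneg hr 4
  simp only [Multiset.map_cons, Multiset.sum_cons] at *
  generalize (r.map (· ^ 3)).sum = u at *
  generalize (r.map (· ^ 4)).sum = v at *
  generalize r.sum = q at *
  obtain rfl : x = 1 - q := by linarith
  unfold cubeSum at h3
  unfold quarticSum
  -- This forces x ≥ 1/3, whence x + 2z - 1 ≥ 0 in the final comparison of e₂.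
  have hc : 1 / 9 ≤ 2 * z ^ 3 + (1 - 2 * z) ^ 3 := by
    nlinarith [mul_nonneg (sub_nonneg.2 hz) (sub_nonneg.2 hz),
      mul_nonneg (mul_nonneg (sub_nonneg.2 hz) (sub_nonneg.2 hz)) (sub_nonneg.2 hz')]
  have hx : 1 / 3 ≤ 1 - q := by nlinarith
  rcases hq.eq_or_lt with rfl | hq
  · nlinarith
  have hu : u = 2 * z ^ 3 + (1 - 2 * z) ^ 3 - (1 - q) ^ 3 := by linarith
  -- `e` is the second elementary symmetric function of the three-part model with largest part `x`
  obtain ⟨e, he⟩ : ∃ e, e * q = 2 * z * (1 - z) ^ 2 - (1 - q) ^ 2 * q :=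
    ⟨(2 * z * (1 - z) ^ 2 - (1 - q) ^ 2 * q) / q, by field_simp⟩
  have hv : 1 - 8 * z * (1 - z) ^ 2 + 2 * e ^ 2 ≤ (1 - q) ^ 4 + v := by
    have : 0 ≤ q ^ 2 * 9 * ((1 - q) ^ 4 + v - (1 - 8 * z * (1 - z) ^ 2 + 2 * e ^ 2)) := by
      have h : q ^ 2 * 9 * ((1 - q) ^ 4 + v - (1 - 8 * z * (1 - z) ^ 2 + 2 * e ^ 2)) =
        9 * v * q ^ 2 + q ^ 2 * 9 * ((1 - q) ^ 4 - (1 - 8 * z * (1 - z) ^ 2)) -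
          18 * (e * q) ^ 2 := by ring
      rw [h, he]
      have h' : 9 * v * q ^ 2 + q ^ 2 * 9 * ((1 - q) ^ 4 - (1 - 8 * z * (1 - z) ^ 2)) -
        18 * (2 * z * (1 - z) ^ 2 - (1 - q) ^ 2 * q) ^ 2 =
        9 * v * q ^ 2 + q ^ 6 - (2 * u ^ 2 + 8 * u * q ^ 3) := by rw [hu]; ring
      rw [h']; linarith
    have := nonneg_of_mul_nonneg_right this (by positivity)
    linarith
  have hez : 2 * z - 3 * z ^ 2 ≤ e := by
    have : 0 ≤ q * (e - (2 * z - 3 * z ^ 2)) := by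
      have h : q * (e - (2 * z - 3 * z ^ 2)) = (1 - q - z) ^ 2 * ((1 - q) + 2 * z - 1) := by
        linear_combination he
      rw [h]
      exact mul_nonneg (sq_nonneg _) (by linarith)
    have := nonneg_of_mul_nonneg_right this hq
    linarith
  have hz0 : 0 ≤ 2 * z - 3 * z ^ 2 := by nlinarith
  have : (2 * z - 3 * z ^ 2) ^ 2 ≤ e ^ 2 := by gcongr
  nlinarith

theorem cubeSum_strictMonoOn : StrictMonoOn cubeSum (Set.Icc (1 / 3) (1 / 2)) := by
  intro w hw z hz hwz
  have := blowup_poly_strictMono (k := 2) (w := w) (z := z) (by norm_num) (by linarith [hw.1]) hwz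
    (by linarith [hz.2])
  simpa [cubeSum] using this

/-- In terms of a = z - 1/3 and d = y - z, the difference of the two sides for L = 1 - y is a
polynomial with nonnegative coefficients. -/
theorem cubeSum_chord {z y : ℝ} (hz : 1 / 3 ≤ z) (hzy : z ≤ y) (hy : y ≤ 1 / 2) {L : ℝ}
    (hL : L ≤ 1 - y) : L * (cubeSum y - cubeSum z) ≤ quarticSum y - quarticSum z := by
  have h1 : cubeSum z ≤ cubeSum y :=
    cubeSum_strictMonoOn.monotoneOn ⟨hz, hzy.trans hy⟩ ⟨hz.trans hzy, hy⟩ hzy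
  have h2 : (1 - y) * (cubeSum y - cubeSum z) ≤ quarticSum y - quarticSum z := by
    obtain ⟨d, hd, rfl⟩ : ∃ d, 0 ≤ d ∧ y = z + d := ⟨y - z, by linarith, by ring⟩
    obtain ⟨a, ha, rfl⟩ : ∃ a, 0 ≤ a ∧ z = 1 / 3 + a := ⟨z - 1 / 3, by linarith, by ring⟩
    have key : quarticSum (1 / 3 + a + d) - quarticSum (1 / 3 + a) -
        (1 - (1 / 3 + a + d)) * (cubeSum (1 / 3 + a + d) - cubeSum (1 / 3 + a)) =
        d * (2 * d * (3 * a + d) + 12 * (a + d) ^ 3 + 12 * (a + d) ^ 2 * a +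
          12 * (a + d) * a ^ 2 + 18 * a ^ 3) := by
      unfold cubeSum quarticSum
      ring
    have : 0 ≤ d * (2 * d * (3 * a + d) + 12 * (a + d) ^ 3 + 12 * (a + d) ^ 2 * a +
          12 * (a + d) * a ^ 2 + 18 * a ^ 3) := by positivity
    linarith
  nlinarith

theorem exists_cubeSum_eq {z s : ℝ} (hz' : z ≤ 1 / 2) (hs : cubeSum z ≤ s)
    (hs' : s ≤ 1 / 4) : ∃ y, z ≤ y ∧ y ≤ 1 / 2 ∧ cubeSum y = s := by
  have hc : ContinuousOn cubeSum (Set.Icc z (1 / 2)) := by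
    unfold cubeSum
    fun_prop
  obtain ⟨y, hy, rfl⟩ := intermediate_value_Icc hz' hc
    ⟨hs, hs'.trans (by norm_num [cubeSum])⟩
  exact ⟨y, hy.1, hy.2, rfl⟩

/-! ### Passing from a complex spectrum to its real parts -/

/-- A multiset of complex numbers with nonnegative real parts of sum one, whose nonreal members
occur in conjugate pairs and have real part at most `1 / 3`. -/
structure IsTournamentSpectrum (R : Multiset ℂ) : Prop where
  re_nonneg : ∀ l ∈ R, 0 ≤ l.re
  sum_re : (R.map Complex.re).sum = 1
  conj_mem : ∀ l ∈ R, l.im ≠ 0 → star l ∈ R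
  re_le : ∀ l ∈ R, l.im ≠ 0 → l.re ≤ 1 / 3

variable {R : Multiset ℂ}

theorem re_pow_three (l : ℂ) : (l ^ 3).re = l.re ^ 3 - 3 * l.re * l.im ^ 2 := by
  simp [pow_succ]
  ring

theorem re_pow_four (l : ℂ) :
    (l ^ 4).re = l.re ^ 4 - 6 * l.re ^ 2 * l.im ^ 2 + l.im ^ 4 := by
  simp [pow_succ]
  ring

theorem IsTournamentSpectrum.nonneg (hR : IsTournamentSpectrum R) :
    ∀ a ∈ R.map Complex.re, 0 ≤ a := fun a ha => by
  obtain ⟨l, hl, rfl⟩ := Multiset.mem_map.1 ha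
  exact hR.re_nonneg l hl

theorem IsTournamentSpectrum.sum_re_cube_le (hR : IsTournamentSpectrum R) :
    (R.map fun l => (l ^ 3).re).sum ≤ ((R.map Complex.re).map (· ^ 3)).sum := by
  rw [Multiset.map_map]
  refine Multiset.sum_map_le_sum_map _ _ fun l hl => ?_
  have := hR.re_nonneg l hl
  rw [re_pow_three, Function.comp_apply]
  have : 0 ≤ 3 * l.re * l.im ^ 2 := by positivity
  linarith

theorem IsTournamentSpectrum.sum_re_cube_le_one (hR : IsTournamentSpectrum R) :
    (R.map fun l => (l ^ 3).re).sum ≤ 1 := by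
  have := sum_cube_le hR.nonneg
  rw [hR.sum_re, one_pow] at this
  exact hR.sum_re_cube_le.trans this

/-- Replacing the spectrum by its real parts. -/
theorem IsTournamentSpectrum.real_part_bound (hR : IsTournamentSpectrum R) {L : ℝ}
    (hL : ∀ l ∈ R, l.im ≠ 0 → 2 * l.re ≤ L) :
    ((R.map Complex.re).map (· ^ 4)).sum - L * ((R.map Complex.re).map (· ^ 3)).sum ≤
      (R.map fun l => (l ^ 4).re).sum - L * (R.map fun l => (l ^ 3).re).sum := by
  simp only [Multiset.map_map, Function.comp_def, ← Multiset.sum_map_mul_left,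
    ← Multiset.sum_map_sub]
  refine Multiset.sum_map_le_sum_map _ _ fun l hl => ?_
  rw [re_pow_three, re_pow_four]
  by_cases h : l.im = 0
  · simp [h]
  · have h0 := hR.re_nonneg l hl
    have h1 := hL l hl h
    -- For l = a + ib the two sides differ by 3ab²(L - 2a) + b⁴.
    have : 0 ≤ 3 * (l.re * l.im ^ 2) * (L - 2 * l.re) :=
      mul_nonneg (by positivity) (by linarith)
    nlinarith [sq_nonneg (l.im ^ 2)]

/-- L = 2/3 is admissible. The real-part bound (2p² + 8p - 1)/9 has slope at least 8/9 > 2/3 in p,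
so it survives lowering p to the true cube sum. -/
theorem IsTournamentSpectrum.two_part_bound (hR : IsTournamentSpectrum R)
    (h0 : 0 ≤ (R.map fun l => (l ^ 3).re).sum) :
    2 * (R.map fun l => (l ^ 3).re).sum ^ 2 + 8 * (R.map fun l => (l ^ 3).re).sum ≤
      9 * (R.map fun l => (l ^ 4).re).sum + 1 := by
  have h1 := hR.real_part_bound (L := 2 / 3) fun l hl h => by linarith [hR.re_le l hl h]
  have h2 := PowerSum.two_part_bound hR.nonneg
  have h3 := hR.sum_re_cube_le
  rw [hR.sum_re] at h2
  nlinarith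

/-- The pair l, `star l` uses 2 Re l of the total; the remaining cubes sum to at most the cube of
what is left. -/
theorem IsTournamentSpectrum.sum_cube_re_le (hR : IsTournamentSpectrum R) {l : ℂ} (hl : l ∈ R)
    (him : l.im ≠ 0) :
    ((R.map Complex.re).map (· ^ 3)).sum ≤ 2 * l.re ^ 3 + (1 - 2 * l.re) ^ 3 := by
  have hc := hR.conj_mem l hl him
  have hn := hR.nonneg
  have hs := hR.sum_re
  obtain ⟨T, rfl⟩ := Multiset.exists_cons_of_mem hl
  rcases Multiset.mem_cons.1 hc with h | h
  · exact absurd (Complex.conj_eq_iff_im.1 h) him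
  obtain ⟨U, rfl⟩ := Multiset.exists_cons_of_mem h
  have hU := sum_cube_le (s := U.map Complex.re) fun a ha => hn a (by simp at ha ⊢; tauto)
  simp only [Multiset.map_cons, Multiset.sum_cons, Complex.star_def, Complex.conj_re] at *
  have : (U.map Complex.re).sum = 1 - 2 * l.re := by linarith
  rw [this] at hU
  linarith

theorem IsTournamentSpectrum.three_part_bound (hR : IsTournamentSpectrum R) {z : ℝ}
    (hz : 1 / 3 ≤ z) (hz' : z ≤ 1 / 2) (h3 : cubeSum z ≤ (R.map fun l => (l ^ 3).re).sum) :
    quarticSum z ≤ (R.map fun l => (l ^ 4).re).sum := by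
  -- L is the maximum of 1/2 and twice the largest real part of a nonreal member.
  obtain ⟨L, hL, hL0, hLs⟩ : ∃ L, (∀ l ∈ R, l.im ≠ 0 → 2 * l.re ≤ L) ∧ 1 / 2 ≤ L ∧
      (L = 1 / 2 ∨ L ≤ 2 / 3 ∧
        ((R.map Complex.re).map (· ^ 3)).sum ≤ 2 * (L / 2) ^ 3 + (1 - L) ^ 3) := by
    by_cases h : ∃ l ∈ R, l.im ≠ 0 ∧ 1 / 4 < l.re
    · obtain ⟨l, hl, hmax⟩ := (R.toFinset.filter fun l => l.im ≠ 0).exists_max_image Complex.re (by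
        obtain ⟨l, hl, hl'⟩ := h
        exact ⟨l, by simp [hl, hl'.1]⟩)
      simp only [Finset.mem_filter, Multiset.mem_toFinset] at hl hmax
      obtain ⟨m, hm, him, hm'⟩ := h
      have hml := hmax m ⟨hm, him⟩
      refine ⟨2 * l.re, fun k hk hi => by linarith [hmax k ⟨hk, hi⟩], by linarith, Or.inr
        ⟨by linarith [hR.re_le l hl.1 hl.2], ?_⟩⟩
      have := hR.sum_cube_re_le hl.1 hl.2
      rwa [mul_div_cancel_left₀ _ two_ne_zero]
    · push Not at h
      exact ⟨1 / 2, fun l hl hi => by linarith [h l hl hi], le_rfl, Or.inl rfl⟩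
  have hb := hR.real_part_bound hL
  have hle := hR.sum_re_cube_le
  have h2 := PowerSum.two_part_bound hR.nonneg
  rw [hR.sum_re] at h2
  have hmul : L * cubeSum z ≤ L * (R.map fun l => (l ^ 3).re).sum := by gcongr
  rcases le_total ((R.map Complex.re).map (· ^ 3)).sum (1 / 4) with h4 | h4
  · obtain ⟨y, hzy, hy, hys⟩ := exists_cubeSum_eq hz' (h3.trans hle) h4
    have h5 := PowerSum.three_part_bound hR.nonneg hR.sum_re (hz.trans hzy) hy hys.symm
    have hLy : L ≤ 1 - y := by
      rcases hLs with rfl | ⟨hL3, hLs⟩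
      · linarith
      -- A large L limits the cube sum of the real parts, hence y; this gives the condition L ≤ 1 -
      -- y of the chord bound.
      · have : cubeSum y ≤ cubeSum (1 - L) := by
          rw [hys]
          refine hLs.trans ?_
          have : cubeSum (1 - L) - (2 * (L / 2) ^ 3 + (1 - L) ^ 3) =
              3 * L * (1 - 3 * L / 2) ^ 2 := by unfold cubeSum; ring
          have : 0 ≤ 3 * L * (1 - 3 * L / 2) ^ 2 := by positivity
          linarith
        have := (cubeSum_strictMonoOn.le_iff_le ⟨hz.trans hzy, hy⟩
          ⟨by linarith, by linarith⟩).1 this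
        linarith
    have h6 := cubeSum_chord hz hzy hy hLy
    rw [← hys] at hb
    linarith
  -- Beyond 1/4 the two-part bound takes over. Here L must be 1/2, since otherwise the cube sum is
  -- at most 2/27 + 1/8 < 1/4.
  · have hL' : L = 1 / 2 := by
      rcases hLs with h | ⟨hL3, hLs⟩
      · exact h
      · have e1 : (1 - L) ^ 3 ≤ (1 / 2) ^ 3 :=
          pow_le_pow_left₀ (by linarith) (by linarith) 3
        have e2 : (L / 2) ^ 3 ≤ (1 / 3) ^ 3 := pow_le_pow_left₀ (by linarith) (by linarith) 3
        linarith
    subst hL'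
    have h6 := cubeSum_chord (L := 1 / 2) hz hz' le_rfl (by norm_num)
    have e1 : cubeSum (1 / 2) = 1 / 4 := by norm_num [cubeSum]
    have e2 : quarticSum (1 / 2) = 1 / 8 := by norm_num [quarticSum]
    rw [e1, e2] at h6
    nlinarith

end PowerSum

/-! ### Traces of powers as power sums of eigenvalues -/

namespace Matrix

open Polynomial

section Trace

variable {n : Type*} [Fintype n] [DecidableEq n] {K : Type*} [Field K] [IsAlgClosed K]

/-- By multiplicativity it suffices to treat constants and linear factors X - m of p; the latter
amount to evaluating the characteristic polynomial at m. -/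
theorem det_aeval_eq_prod_roots (A : Matrix n n K) (p : K[X]) :
    (aeval A p).det = (A.charpoly.roots.map fun l => p.eval l).prod := by
  have hcard : A.charpoly.roots.card = Fintype.card n := by
    rw [← (IsAlgClosed.splits A.charpoly).natDegree_eq_card_roots, charpoly_natDegree_eq_dim]
  have hlin : ∀ m : K, (aeval A (X - C m)).det = (A.charpoly.roots.map fun l => l - m).prod := by
    intro m
    have h1 : A.charpoly.eval m = (A.charpoly.roots.map fun l => m - l).prod := by
      conv_lhs => rw [(IsAlgClosed.splits A.charpoly).eq_prod_roots_of_monic A.charpoly_monic]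
      rw [eval_multiset_prod, Multiset.map_map]
      simp
    have h2 : aeval A (X - C m) = -(scalar n m - A) := by
      simp [algebraMap_eq_diagonal, Pi.algebraMap_def]
    rw [h2, det_neg, ← eval_charpoly, h1, ← hcard, ← Multiset.card_map (fun l => m - l),
      ← Multiset.prod_map_neg, Multiset.map_map]
    simp
  have hC : ∀ c : K, (aeval A (C c)).det = (A.charpoly.roots.map fun _ => c).prod := by
    intro c
    simp [algebraMap_eq_diagonal, Pi.algebraMap_def, hcard]
  let D : K[X] →* K := detMonoidHom.comp (aeval A : K[X] →ₐ[K] Matrix n n K).toMonoidHom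
  have hD : ∀ q, D q = (aeval A q).det := fun q => rfl
  have hp := (IsAlgClosed.splits p).eq_prod_roots
  rw [← hD, hp, map_mul, map_multiset_prod, hD, hC, Multiset.map_map]
  simp only [Function.comp_def, hD, hlin]
  rw [Multiset.prod_map_prod_map, ← Multiset.prod_map_mul]
  congr 1
  refine Multiset.map_congr rfl fun l _ => ?_
  rw [eval_mul, eval_C, eval_multiset_prod, Multiset.map_map]
  simp

theorem trace_pow_eq_sum_roots (A : Matrix n n K) (k : ℕ) :
    (A ^ k).trace = (A.charpoly.roots.map (· ^ k)).sum := by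
  have h : (A ^ k).charpoly = (A.charpoly.roots.map fun l => X - C (l ^ k)).prod := by
    refine Polynomial.funext fun x => ?_
    rw [eval_charpoly, eval_multiset_prod, Multiset.map_map]
    -- This choice of polynomial evaluates the characteristic polynomial of A^k at x.
    have := det_aeval_eq_prod_roots A (C x - X ^ k)
    simp [algebraMap_eq_diagonal, Pi.algebraMap_def] at this
    simpa using this
  rw [trace_eq_sum_roots_charpoly, h]
  have := roots_multiset_prod_X_sub_C (A.charpoly.roots.map (· ^ k))
  rw [Multiset.map_map] at this
  exact congrArg Multiset.sum this

end Trace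

/-! ### Spectrum of a positive tournament matrix -/

section Spectrum

variable {n : Type*} [Fintype n] [DecidableEq n]

theorem exists_eigenvector_of_mem_roots {K : Type*} [Field K] {A : Matrix n n K} {l : K}
    (hl : l ∈ A.charpoly.roots) :
    ∃ v ≠ 0, A *ᵥ v = l • v := by
  have h := isRoot_of_mem_roots hl
  rw [IsRoot, eval_charpoly] at h
  obtain ⟨v, hv, h⟩ := exists_mulVec_eq_zero_iff.2 h
  refine ⟨v, hv, ?_⟩
  rw [sub_mulVec, sub_eq_zero] at h
  rw [← h]
  ext i
  simp [scalar_apply, mulVec_diagonal]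

theorem mem_roots_of_eigenvector {K : Type*} [Field K] {A : Matrix n n K} {l : K} {v : n → K}
    (hv : v ≠ 0)
    (h : A *ᵥ v = l • v) : l ∈ A.charpoly.roots := by
  rw [mem_roots A.charpoly_monic.ne_zero, IsRoot, eval_charpoly]
  refine exists_mulVec_eq_zero_iff.1 ⟨v, hv, ?_⟩
  rw [sub_mulVec, sub_eq_zero, h]
  ext i
  simp [scalar_apply, mulVec_diagonal]

/-- Collatz–Wielandt: a positive matrix has a positive eigenvector, whose eigenvalue bounds
the modulus of all complex eigenvalues. -/
theorem exists_perron_root [Nonempty n] {A : Matrix n n ℝ} (hA : ∀ i j, 0 < A i j) :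
    ∃ r : ℝ, (∃ v : n → ℝ, v ≠ 0 ∧ A *ᵥ v = r • v) ∧
      ∀ l ∈ (A.map Complex.ofReal).charpoly.roots, ‖l‖ ≤ r := by
  obtain ⟨M, hM⟩ : ∃ M, ∀ (t : ℝ) (x : n → ℝ), x ∈ stdSimplex ℝ n → t • x ≤ A *ᵥ x → t ≤ M := by
    refine ⟨∑ i, ∑ j, A i j, fun t x hx h => ?_⟩
    calc t = ∑ i, t * x i := by rw [← Finset.mul_sum, hx.2, mul_one]
      _ ≤ ∑ i, ∑ j, A i j * x j := Finset.sum_le_sum fun i _ => h i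
      _ ≤ ∑ i, ∑ j, A i j := Finset.sum_le_sum fun i _ => Finset.sum_le_sum fun j _ =>
          mul_le_of_le_one_right (hA i j).le (mem_Icc_of_mem_stdSimplex hx j).2
  -- The Perron root is the largest t with t x ≤ A x for some x in the simplex; the bound M makes
  -- the feasible set compact.
  let S : Set (ℝ × (n → ℝ)) := (Set.Icc 0 M ×ˢ stdSimplex ℝ n) ∩ {p | p.1 • p.2 ≤ A *ᵥ p.2}
  have hSc : IsCompact S := by
    refine (isCompact_Icc.prod (isCompact_stdSimplex ℝ n)).inter_right (isClosed_le ?_ ?_)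
    · fun_prop
    · exact Continuous.matrix_mulVec continuous_const continuous_snd
  have hpos : ∀ x : n → ℝ, 0 ≤ x → x ≠ 0 → ∀ i, 0 < (A *ᵥ x) i := by
    intro x hx hx0 i
    obtain ⟨j, hj⟩ := Function.ne_iff.1 hx0
    exact Finset.sum_pos' (fun k _ => mul_nonneg (hA i k).le (hx k))
      ⟨j, Finset.mem_univ _, mul_pos (hA i j) (lt_of_le_of_ne (hx j) (Ne.symm hj))⟩
  have hnorm : ∀ (t : ℝ) (x : n → ℝ), 0 ≤ t → 0 ≤ x → x ≠ 0 → t • x ≤ A *ᵥ x →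
      ∃ y, (t, y) ∈ S := by
    intro t x ht hx hx0 h
    obtain ⟨j, hj⟩ := Function.ne_iff.1 hx0
    have hs : 0 < ∑ i, x i := Finset.sum_pos' (fun k _ => hx k)
      ⟨j, Finset.mem_univ _, lt_of_le_of_ne (hx j) (Ne.symm hj)⟩
    have hmem : (∑ i, x i)⁻¹ • x ∈ stdSimplex ℝ n := by
      refine ⟨fun i => mul_nonneg (inv_nonneg.2 hs.le) (hx i), ?_⟩
      simp only [Pi.smul_apply, smul_eq_mul, ← Finset.mul_sum]
      exact inv_mul_cancel₀ hs.ne'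
    have hle : t • ((∑ i, x i)⁻¹ • x) ≤ A *ᵥ ((∑ i, x i)⁻¹ • x) := by
      rw [mulVec_smul, smul_comm]
      exact smul_le_smul_of_nonneg_left h (inv_nonneg.2 hs.le)
    exact ⟨_, ⟨⟨ht, hM t _ hmem hle⟩, hmem⟩, hle⟩
  have hSn : S.Nonempty := by
    obtain ⟨y, hy⟩ := hnorm 0 1 le_rfl zero_le_one one_ne_zero (by
      rw [zero_smul]
      exact fun i => (hpos 1 zero_le_one one_ne_zero i).le)
    exact ⟨_, hy⟩
  obtain ⟨⟨r, x⟩, hrx, hmax⟩ := hSc.exists_isMaxOn hSn continuous_fst.continuousOn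
  have hr : ∀ (t : ℝ) (x : n → ℝ), 0 ≤ t → 0 ≤ x → x ≠ 0 → t • x ≤ A *ᵥ x → t ≤ r := by
    intro t x ht hx hx0 h
    obtain ⟨y, hy⟩ := hnorm t x ht hx hx0 h
    exact hmax hy
  have hx0 : 0 ≤ x := hrx.1.2.1
  have hxne : x ≠ 0 := by
    rintro rfl
    simpa using hrx.1.2.2
  refine ⟨r, ⟨x, hxne, ?_⟩, ?_⟩
  · by_contra hne
    -- If A x - r x is nonzero, applying A makes it strictly positive, so A x is feasible for a
    -- value larger than r.
    have hy0 : 0 ≤ A *ᵥ x - r • x := sub_nonneg.2 hrx.2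
    have h1 := hpos _ hy0 (sub_ne_zero.2 hne)
    have h2 := hpos x hx0 hxne
    obtain ⟨i, -, hi⟩ := Finset.univ.exists_min_image
      (fun i => (A *ᵥ (A *ᵥ x - r • x)) i / (A *ᵥ x) i) Finset.univ_nonempty
    have hε := div_pos (h1 i) (h2 i)
    have := hr (r + (A *ᵥ (A *ᵥ x - r • x)) i / (A *ᵥ x) i) (A *ᵥ x)
      (add_nonneg hrx.1.1.1 hε.le) (fun k => (h2 k).le)
      (fun h => (h2 i).ne' (congrFun h i)) (fun k => by
        have h3 := (le_div_iff₀ (h2 k)).1 (hi k (Finset.mem_univ k))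
        have h4 : (A *ᵥ (A *ᵥ x - r • x)) k = (A *ᵥ (A *ᵥ x)) k - r * (A *ᵥ x) k := by
          rw [mulVec_sub, mulVec_smul]
          rfl
        rw [h4] at h3
        rw [Pi.smul_apply, smul_eq_mul, add_mul]
        linarith)
    linarith
  · intro l hl
    obtain ⟨v, hv, h⟩ := exists_eigenvector_of_mem_roots hl
    -- By the triangle inequality, the entrywise modulus of an eigenvector is feasible for t = ‖l‖.
    refine hr ‖l‖ (fun i => ‖v i‖) (norm_nonneg _) (fun i => norm_nonneg _) ?_ fun i => ?_
    · contrapose! hv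
      ext i
      simpa using congrFun hv i
    · have : ‖l‖ * ‖v i‖ = ‖∑ j, (A i j : ℂ) * v j‖ := by
        rw [← norm_mul]
        exact congrArg norm (congrFun h i).symm
      rw [Pi.smul_apply, smul_eq_mul, this]
      refine (norm_sum_le _ _).trans_eq (Finset.sum_congr rfl fun j _ => ?_)
      rw [norm_mul, Complex.norm_real, Real.norm_of_nonneg (hA i j).le]

theorem star_mem_roots_charpoly {A : Matrix n n ℝ} {l : ℂ}
    (hl : l ∈ (A.map Complex.ofReal).charpoly.roots) :
    star l ∈ (A.map Complex.ofReal).charpoly.roots := by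
  obtain ⟨v, hv, h⟩ := exists_eigenvector_of_mem_roots hl
  refine mem_roots_of_eigenvector (v := star v) (by simpa using hv) ?_
  ext i
  have := congrArg star (congrFun h i)
  simpa [mulVec, dotProduct] using this

/-- A + Aᵀ is c times the all-ones matrix, so an eigenvector v satisfies 2 Re l · ∑ |vᵢ|² = c |∑
vᵢ|². -/
theorem re_nonneg_of_add_transpose_const {A : Matrix n n ℝ} {c : ℝ} (hc : 0 ≤ c)
    (hA : ∀ i j, A i j + A j i = c) {l : ℂ}
    (hl : l ∈ (A.map Complex.ofReal).charpoly.roots) : 0 ≤ l.re := by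
  obtain ⟨v, hv, h⟩ := exists_eigenvector_of_mem_roots hl
  have h1 : ∑ i, ∑ j, star (v i) * (A i j : ℂ) * v j = l * ∑ i, star (v i) * v i := by
    rw [Finset.mul_sum]
    refine Finset.sum_congr rfl fun i _ => ?_
    have := congrFun h i
    simp only [mulVec, dotProduct, map_apply, Pi.smul_apply, smul_eq_mul] at this
    simp only [mul_assoc]
    rw [← Finset.mul_sum, this]
    ring
  have h2 : ∑ i, ∑ j, star (v i) * (A j i : ℂ) * v j = star l * ∑ i, star (v i) * v i := by
    have := congrArg star h1
    simp only [star_sum, star_mul', Complex.star_def, Complex.conj_conj,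
      Complex.conj_ofReal] at this
    rw [Finset.sum_comm] at this
    simp only [Complex.star_def]
    calc _ = _ := Finset.sum_congr rfl fun i _ => Finset.sum_congr rfl fun j _ => by ring
      _ = _ := this
      _ = _ := by congr 1; exact Finset.sum_congr rfl fun i _ => mul_comm _ _
  have h3 : (c : ℂ) * (star (∑ i, v i) * ∑ i, v i) =
      (l + star l) * ∑ i, star (v i) * v i := by
    rw [add_mul, ← h1, ← h2, ← Finset.sum_add_distrib, star_sum, Finset.sum_mul_sum,
      Finset.mul_sum]
    refine Finset.sum_congr rfl fun i _ => ?_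
    rw [Finset.mul_sum, ← Finset.sum_add_distrib]
    refine Finset.sum_congr rfl fun j _ => ?_
    rw [← hA i j]
    push_cast
    ring
  have h4 : ∀ w : ℂ, star w * w = ((‖w‖ ^ 2 : ℝ) : ℂ) := fun w => by
    simpa using Complex.conj_mul' w
  have h5 : c * ‖∑ i, v i‖ ^ 2 = 2 * l.re * ∑ i, ‖v i‖ ^ 2 := by
    simp only [h4] at h3
    rw [Complex.star_def, Complex.add_conj] at h3
    exact_mod_cast h3
  have h6 : 0 < ∑ i, ‖v i‖ ^ 2 := by
    obtain ⟨j, hj⟩ := Function.ne_iff.1 hv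
    exact Finset.sum_pos' (fun k _ => by positivity)
      ⟨j, Finset.mem_univ _, pow_pos (norm_pos_iff.2 hj) 2⟩
  by_contra hneg
  nlinarith [mul_nonneg hc (sq_nonneg ‖∑ i, v i‖), mul_pos (neg_pos.2 (not_le.1 hneg)) h6]

theorem isTournamentSpectrum_roots_charpoly {A : Matrix n n ℝ} (hpos : ∀ i j, 0 < A i j) {c : ℝ}
    (hA : ∀ i j, A i j + A j i = c) (htr : A.trace = 1) :
    PowerSum.IsTournamentSpectrum (A.map Complex.ofReal).charpoly.roots := by
  have hn : Nonempty n := by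
    by_contra h
    rw [not_nonempty_iff] at h
    simp at htr
  obtain ⟨i⟩ := id hn
  have hc : 0 ≤ c := by rw [← hA i i]; linarith [hpos i i]
  have hre := fun l => re_nonneg_of_add_transpose_const hc hA (l := l)
  have hsum : ((A.map Complex.ofReal).charpoly.roots.map Complex.re).sum = 1 := by
    have h := trace_eq_sum_roots_charpoly (A.map Complex.ofReal)
    have h' : (A.map Complex.ofReal).trace = ((1 : ℝ) : ℂ) := by
      rw [← htr]
      simp [trace]
    have := congrArg Complex.reAddGroupHom (h'.symm.trans h)
    rw [map_multiset_sum] at this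
    exact this.symm
  refine ⟨hre, hsum, fun l hl _ => star_mem_roots_charpoly hl, fun l hl him => ?_⟩
  obtain ⟨r, ⟨v, hv, hvr⟩, hr⟩ := exists_perron_root hpos
  have hrm : (r : ℂ) ∈ (A.map Complex.ofReal).charpoly.roots := by
    refine mem_roots_of_eigenvector (v := fun i => (v i : ℂ)) ?_ ?_
    · contrapose! hv
      ext i
      simpa using congrFun hv i
    · ext i
      have := congrFun hvr i
      simp only [mulVec, dotProduct, map_apply, Pi.smul_apply, smul_eq_mul] at this ⊢
      exact_mod_cast this
  have hlr := (Complex.re_le_norm l).trans (hr l hl)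
  have hstar := star_mem_roots_charpoly hl
  generalize (A.map Complex.ofReal).charpoly.roots = R at *
  obtain ⟨T, rfl⟩ := Multiset.exists_cons_of_mem hl
  rcases Multiset.mem_cons.1 hstar with h | h
  · exact absurd (Complex.conj_eq_iff_im.1 h) him
  obtain ⟨U, rfl⟩ := Multiset.exists_cons_of_mem h
  -- The real root r is distinct from l and `star l`, so 2 Re l + r ≤ 1; with Re l ≤ r this gives Re
  -- l ≤ 1/3.
  have hrU : (r : ℂ) ∈ U := by
    simp only [Multiset.mem_cons] at hrm
    rcases hrm with h | h | h
    · exact absurd (by simp [← h]) him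
    · exact absurd (by simpa using (congrArg Complex.im h).symm) him
    · exact h
  obtain ⟨V, rfl⟩ := Multiset.exists_cons_of_mem hrU
  have hV : 0 ≤ (V.map Complex.re).sum := Multiset.sum_nonneg fun a ha => by
    obtain ⟨m, hm, rfl⟩ := Multiset.mem_map.1 ha
    exact hre m (by simp [hm])
  simp only [Multiset.map_cons, Multiset.sum_cons, Complex.star_def, Complex.conj_re,
    Complex.ofReal_re] at hsum
  linarith

theorem sum_re_roots_charpoly_pow (A : Matrix n n ℝ) (k : ℕ) :
    ((A.map Complex.ofReal).charpoly.roots.map fun l => (l ^ k).re).sum = (A ^ k).trace := by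
  have h := trace_pow_eq_sum_roots (A.map Complex.ofReal) k
  have h' : (A.map Complex.ofReal) ^ k = (A ^ k).map Complex.ofReal :=
    (map_pow Complex.ofRealHom.mapMatrix A k).symm
  have h'' : ((A ^ k).map Complex.ofReal).trace = (((A ^ k).trace : ℝ) : ℂ) := by simp [trace]
  rw [h', h''] at h
  have := congrArg Complex.reAddGroupHom h
  rw [map_multiset_sum, Multiset.map_map] at this
  exact this.symm

end Spectrum

/-! ### Closed walks in weighted tournaments -/

section Cycle

variable {n : ℕ}

theorem sum_pi_fin_succ {α M : Type*} [Fintype α] [AddCommMonoid M] {k : ℕ}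
    (F : (Fin (k + 1) → α) → M) : ∑ x, F x = ∑ a, ∑ y : Fin k → α, F (vecCons a y) := by
  rw [← (Fin.consEquiv fun _ => α).sum_comp, Fintype.sum_prod_type]
  rfl

theorem sum_cycle_three (A : Matrix (Fin n) (Fin n) ℝ) :
    ∑ x : Fin 3 → Fin n, ∏ i, A (x i) (x (i + 1)) = (A ^ 3).trace := by
  simp only [sum_pi_fin_succ, Fin.prod_univ_three, Fintype.sum_unique, trace, diag_apply,
    pow_succ, pow_zero, one_mul, mul_apply, Finset.sum_mul]
  refine Finset.sum_congr rfl fun a _ => ?_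
  rw [Finset.sum_comm]
  rfl

theorem sum_cycle_four (A : Matrix (Fin n) (Fin n) ℝ) :
    ∑ x : Fin 4 → Fin n, ∏ i, A (x i) (x (i + 1)) = (A ^ 4).trace := by
  simp only [sum_pi_fin_succ, Fin.prod_univ_four, Fintype.sum_unique, trace, diag_apply,
    pow_succ, pow_zero, one_mul, mul_apply, Finset.sum_mul]
  refine Finset.sum_congr rfl fun a _ => ?_
  calc _ = ∑ b, ∑ d, ∑ c, A a b * A b c * A c d * A d a :=
        Finset.sum_congr rfl fun b _ => Finset.sum_comm
    _ = ∑ d, ∑ b, ∑ c, A a b * A b c * A c d * A d a := Finset.sum_comm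
    _ = _ := Finset.sum_congr rfl fun d _ => Finset.sum_comm

/-- The normalised density of closed walks of length `k`. -/
noncomputable def walkDensity (A : Matrix (Fin n) (Fin n) ℝ) (k : ℕ) : ℝ := (A ^ k).trace / n ^ k

/-- A matrix with positive entries representing a weighted tournament. -/
structure IsPosTournament (A : Matrix (Fin n) (Fin n) ℝ) : Prop where
  pos : ∀ i j, 0 < A i j
  add_swap : ∀ i j, A i j + A j i = 1
  ne_zero : n ≠ 0

theorem IsPosTournament.exists_spectrum {A : Matrix (Fin n) (Fin n) ℝ} (hA : A.IsPosTournament) :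
    ∃ R : Multiset ℂ, PowerSum.IsTournamentSpectrum R ∧
      ∀ k, (R.map fun l => (l ^ k).re).sum = 2 ^ k * A.walkDensity k := by
  have hn : (n : ℝ) ≠ 0 := Nat.cast_ne_zero.2 hA.ne_zero
  have hn' : 0 < (n : ℝ) := by positivity
  refine ⟨(((2 / n : ℝ) • A).map Complex.ofReal).charpoly.roots,
    isTournamentSpectrum_roots_charpoly (c := 2 / n) (fun i j => ?_) (fun i j => ?_) ?_,
    fun k => ?_⟩
  · exact mul_pos (by positivity) (hA.pos i j)
  · rw [smul_apply, smul_apply, ← smul_add, hA.add_swap, smul_eq_mul, mul_one]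
  · have : A.trace = n / 2 := by
      have : ∀ i, A i i = 1 / 2 := fun i => by linarith [hA.add_swap i i]
      simp [trace, this]
      ring
    rw [trace_smul, this, smul_eq_mul]
    field_simp
  · rw [sum_re_roots_charpoly_pow, _root_.smul_pow, trace_smul, smul_eq_mul, walkDensity, div_pow]
    ring

theorem IsPosTournament.walkDensity_three_nonneg {A : Matrix (Fin n) (Fin n) ℝ}
    (hA : A.IsPosTournament) : 0 ≤ A.walkDensity 3 := by
  rw [walkDensity, ← sum_cycle_three]
  exact div_nonneg (Finset.sum_nonneg fun x _ => Finset.prod_nonneg fun i _ => (hA.pos _ _).le)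
    (by positivity)

end Cycle

end Matrix

/-! ### L¹-continuity of cycle densities -/

theorem Finset.abs_prod_sub_prod_le {ι : Type*} (s : Finset ι) {u v : ι → ℝ}
    (hu : ∀ i ∈ s, u i ∈ Set.Icc (0 : ℝ) 1) (hv : ∀ i ∈ s, v i ∈ Set.Icc (0 : ℝ) 1) :
    |∏ i ∈ s, u i - ∏ i ∈ s, v i| ≤ ∑ i ∈ s, |u i - v i| := by
  classical
  induction s using Finset.induction_on with
  | empty => simp
  | insert a s ha ih =>
    rw [prod_insert ha, prod_insert ha, sum_insert ha]
    have hu' : ∀ i ∈ s, u i ∈ Set.Icc (0 : ℝ) 1 := fun i hi => hu i (mem_insert_of_mem hi)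
    have hv' : ∀ i ∈ s, v i ∈ Set.Icc (0 : ℝ) 1 := fun i hi => hv i (mem_insert_of_mem hi)
    have h1 := ih hu' hv'
    have h2 := hv a (mem_insert_self a s)
    have h3 : 0 ≤ ∏ i ∈ s, u i := prod_nonneg fun i hi => (hu' i hi).1
    have h4 : ∏ i ∈ s, u i ≤ 1 := prod_le_one (fun i hi => (hu' i hi).1) fun i hi => (hu' i hi).2
    calc |u a * ∏ i ∈ s, u i - v a * ∏ i ∈ s, v i|
        = |(u a - v a) * ∏ i ∈ s, u i + v a * (∏ i ∈ s, u i - ∏ i ∈ s, v i)| := by ring_nf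
      _ ≤ |u a - v a| * ∏ i ∈ s, u i + v a * |∏ i ∈ s, u i - ∏ i ∈ s, v i| := by
          refine (abs_add_le _ _).trans_eq ?_
          rw [abs_mul, abs_mul, abs_of_nonneg h3, abs_of_nonneg h2.1]
      _ ≤ |u a - v a| * 1 + 1 * |∏ i ∈ s, u i - ∏ i ∈ s, v i| := by
          gcongr
          exact h2.2
      _ ≤ _ := by linarith

theorem measurePreserving_pair_eval {ℓ : ℕ} {i j : Fin ℓ} (hij : i ≠ j) :
    MeasurePreserving (fun x : Fin ℓ → unitInterval => (x i, x j)) volume volume := by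
  refine ⟨by fun_prop, ?_⟩
  have h := ProbabilityTheory.iIndepFun_pi (μ := fun _ : Fin ℓ => (volume : Measure unitInterval))
    (X := fun _ => id) fun _ => aemeasurable_id
  have e := fun k : Fin ℓ =>
    (measurePreserving_eval (fun _ : Fin ℓ => (volume : Measure unitInterval)) k).map_eq
  have h2 := (h.indepFun hij).map_prod_eq_prod_map_map (measurable_pi_apply i).aemeasurable
    (measurable_pi_apply j).aemeasurable
  exact h2.trans (congrArg₂ Measure.prod (e i) (e j))

namespace TournamentLimit

theorem apply_nonneg (W : TournamentLimit) (x y : unitInterval) : 0 ≤ W.toFun x y :=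
  (W.mem_Icc' x y).1

theorem apply_le_one (W : TournamentLimit) (x y : unitInterval) : W.toFun x y ≤ 1 :=
  (W.mem_Icc' x y).2

theorem aemeasurable_eval (W : TournamentLimit) {ℓ : ℕ} {i j : Fin ℓ} (hij : i ≠ j) :
    AEMeasurable fun x : Fin ℓ → unitInterval => W.toFun (x i) (x j) :=
  W.aemeasurable'.comp_quasiMeasurePreserving
    (measurePreserving_pair_eval hij).quasiMeasurePreserving

theorem ne_add_one {ℓ : ℕ} [NeZero ℓ] (hℓ : 2 ≤ ℓ) (i : Fin ℓ) : i ≠ i + 1 := by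
  obtain ⟨k, rfl⟩ : ∃ k, ℓ = k + 2 := ⟨ℓ - 2, by omega⟩
  simp

theorem integrable_prod (W : TournamentLimit) {ℓ : ℕ} {ι : Type*} (s : Finset ι)
    {i j : ι → Fin ℓ} (hij : ∀ k, i k ≠ j k) :
    Integrable fun x : Fin ℓ → unitInterval => ∏ k ∈ s, W.toFun (x (i k)) (x (j k)) := by
  refine Integrable.of_bound (C := 1)
    (Finset.aemeasurable_fun_prod s fun k _ => W.aemeasurable_eval (hij k)).aestronglyMeasurable
    (.of_forall fun x => ?_)
  rw [Real.norm_of_nonneg (Finset.prod_nonneg fun k _ => W.apply_nonneg _ _)]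
  exact Finset.prod_le_one (fun k _ => W.apply_nonneg _ _) fun k _ => W.apply_le_one _ _

theorem integrable_sub (W V : TournamentLimit) :
    Integrable fun p : unitInterval × unitInterval => W.toFun p.1 p.2 - V.toFun p.1 p.2 := by
  refine Integrable.of_bound (C := 1) (W.aemeasurable'.sub V.aemeasurable').aestronglyMeasurable
    (.of_forall fun p => ?_)
  rw [Real.norm_eq_abs, abs_le]
  constructor <;> linarith [W.apply_nonneg p.1 p.2, W.apply_le_one p.1 p.2, V.apply_nonneg p.1 p.2,
    V.apply_le_one p.1 p.2]

/-- Bound the difference of products by the sum of the factor differences; each factor involves two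
distinct coordinates, whose joint law is uniform on the square. -/
theorem abs_cycleDensity_sub_le (W V : TournamentLimit) {ℓ : ℕ} [NeZero ℓ] (hℓ : 2 ≤ ℓ) :
    |W.cycleDensity ℓ - V.cycleDensity ℓ| ≤
      ℓ * ∫ p : unitInterval × unitInterval, |W.toFun p.1 p.2 - V.toFun p.1 p.2| := by
  have hint : ∀ i : Fin ℓ, Integrable fun x : Fin ℓ → unitInterval =>
      |W.toFun (x i) (x (i + 1)) - V.toFun (x i) (x (i + 1))| := fun i =>
    ((measurePreserving_pair_eval (ne_add_one hℓ i)).integrable_comp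
      (W.integrable_sub V).abs.aestronglyMeasurable).2 (W.integrable_sub V).abs
  rw [cycleDensity, cycleDensity, ← integral_sub (W.integrable_prod _ (ne_add_one hℓ))
    (V.integrable_prod _ (ne_add_one hℓ))]
  calc _ ≤ ∫ x : Fin ℓ → unitInterval, |∏ i, W.toFun (x i) (x (i + 1)) -
          ∏ i, V.toFun (x i) (x (i + 1))| := abs_integral_le_integral_abs
    _ ≤ ∫ x : Fin ℓ → unitInterval, ∑ i, |W.toFun (x i) (x (i + 1)) -
          V.toFun (x i) (x (i + 1))| := by
        refine integral_mono_of_nonneg (.of_forall fun _ => abs_nonneg _)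
          (integrable_finsetSum _ fun i _ => hint i) (.of_forall fun x => ?_)
        exact Finset.abs_prod_sub_prod_le _ (fun i _ => W.mem_Icc' _ _) fun i _ => V.mem_Icc' _ _
    _ = ∑ i : Fin ℓ, ∫ p : unitInterval × unitInterval, |W.toFun p.1 p.2 - V.toFun p.1 p.2| := by
        rw [integral_finsetSum _ fun i _ => hint i]
        refine Finset.sum_congr rfl fun i _ => ?_
        have hp := measurePreserving_pair_eval (ne_add_one hℓ i)
        conv_rhs => rw [← hp.map_eq]
        rw [integral_map hp.aemeasurable]
        rw [hp.map_eq]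
        exact (W.integrable_sub V).abs.aestronglyMeasurable
    _ = _ := by simp

end TournamentLimit

/-! ### Uniform partitions of the unit interval -/

namespace unitInterval

/-- The cell of `x` in the partition of the unit interval into `n + 1` intervals. -/
noncomputable def cell (n : ℕ) (x : unitInterval) : Fin (n + 1) :=
  -- The minimum only matters at x = 1, which it puts into the last cell.
  ⟨min ⌊((n : ℝ) + 1) * x⌋₊ n, by omega⟩

/-- The left end point of a cell. -/
noncomputable def node (n : ℕ) (i : Fin (n + 1)) : unitInterval :=
  ⟨(i : ℝ) / (n + 1), by positivity, by
    rw [div_le_one (by positivity)]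
    have : (i : ℝ) ≤ n := by exact_mod_cast Nat.lt_succ_iff.1 i.2
    linarith⟩

theorem measurable_cell (n : ℕ) : Measurable (cell n) := by
  have h : Measurable fun x : unitInterval => min ⌊((n : ℝ) + 1) * x⌋₊ n := by fun_prop
  refine measurable_to_countable' fun i => ?_
  have : cell n ⁻¹' {i} = (fun x : unitInterval => min ⌊((n : ℝ) + 1) * x⌋₊ n) ⁻¹' {(i : ℕ)} := by
    ext x
    simp [cell, Fin.ext_iff]
  rw [this]
  exact h (measurableSet_singleton _)

theorem volume_cell (n : ℕ) (i : Fin (n + 1)) :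
    volume (cell n ⁻¹' {i}) = ENNReal.ofReal (1 / (n + 1)) := by
  have hn : (0 : ℝ) < n + 1 := by positivity
  by_cases hi : (i : ℕ) < n
  · have : cell n ⁻¹' {i} = Set.Ico (node n i) (node n ⟨i + 1, by omega⟩) := by
      ext x
      have hx := x.2.1
      simp only [cell, Set.mem_preimage, Set.mem_singleton_iff, Fin.ext_iff, Set.mem_Ico,
        ← Subtype.coe_le_coe, ← Subtype.coe_lt_coe, node]
      rw [div_le_iff₀ hn, lt_div_iff₀ hn]
      have : min ⌊((n : ℝ) + 1) * x⌋₊ n = i ↔ ⌊((n : ℝ) + 1) * x⌋₊ = i := by omega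
      rw [this, Nat.floor_eq_iff (by positivity)]
      push_cast
      rw [mul_comm]
    rw [this, volume_Ico]
    congr 1
    simp only [node]
    push_cast
    ring
  · have hin : (i : ℕ) = n := by omega
    have : cell n ⁻¹' {i} = Set.Ici (node n i) := by
      ext x
      have hx := x.2.1
      simp only [cell, Set.mem_preimage, Set.mem_singleton_iff, Fin.ext_iff, Set.mem_Ici,
        ← Subtype.coe_le_coe, node]
      rw [div_le_iff₀ hn, hin]
      have : min ⌊((n : ℝ) + 1) * x⌋₊ n = n ↔ n ≤ ⌊((n : ℝ) + 1) * x⌋₊ := by omega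
      rw [this, Nat.le_floor_iff (by positivity), mul_comm]
    rw [this, volume_Ici]
    congr 1
    simp only [node, hin]
    field_simp
    ring

theorem integral_comp_cell (n ℓ : ℕ) (F : (Fin ℓ → Fin (n + 1)) → ℝ) :
    ∫ x : Fin ℓ → unitInterval, F (fun i => cell n (x i)) =
      (∑ y, F y) / ((n : ℝ) + 1) ^ ℓ := by
  have hm : Measurable fun (x : Fin ℓ → unitInterval) i => cell n (x i) :=
    measurable_pi_lambda _ fun i => (measurable_cell n).comp (measurable_pi_apply i)
  have hv : ∀ y : Fin ℓ → Fin (n + 1),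
      (Measure.map (fun (x : Fin ℓ → unitInterval) i => cell n (x i)) volume).real {y} =
        1 / ((n : ℝ) + 1) ^ ℓ := by
    intro y
    rw [map_measureReal_apply hm (measurableSet_singleton _)]
    have : (fun (x : Fin ℓ → unitInterval) i => cell n (x i)) ⁻¹' {y} =
        Set.univ.pi fun i => cell n ⁻¹' {y i} := by
      ext x
      simp [funext_iff]
    rw [this, measureReal_def, volume_pi_pi]
    simp only [volume_cell, Finset.prod_const, Finset.card_univ, Fintype.card_fin]
    rw [ENNReal.toReal_pow, ENNReal.toReal_ofReal (by positivity), one_div_pow]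
  rw [← integral_map (f := F) hm.aemeasurable (by fun_prop), integral_fintype (.of_finite)]
  simp only [hv, smul_eq_mul]
  rw [← Finset.mul_sum]
  ring

theorem tendsto_node_cell (x : unitInterval) :
    Filter.Tendsto (fun n => node n (cell n x)) Filter.atTop (nhds x) := by
  rw [tendsto_subtype_rng]
  refine tendsto_iff_dist_tendsto_zero.2 (squeeze_zero (fun _ => dist_nonneg) (fun n => ?_)
    tendsto_one_div_add_atTop_nhds_zero_nat)
  have hn : (0 : ℝ) < n + 1 := by positivity
  have hx := x.2
  rw [Real.dist_eq, abs_le]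
  simp only [node, cell]
  have h1 := Nat.floor_le (a := ((n : ℝ) + 1) * x) (mul_nonneg hn.le hx.1)
  have h2 := Nat.lt_floor_add_one (((n : ℝ) + 1) * x)
  have h3 : ((min ⌊((n : ℝ) + 1) * x⌋₊ n : ℕ) : ℝ) ≤ ((n : ℝ) + 1) * x :=
    le_trans (by exact_mod_cast min_le_left _ _) h1
  have h4 : ((n : ℝ) + 1) * x ≤ ((min ⌊((n : ℝ) + 1) * x⌋₊ n : ℕ) : ℝ) + 1 := by
    rcases min_choice ⌊((n : ℝ) + 1) * x⌋₊ n with h | h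
    · rw [h]; exact h2.le
    · rw [h]; nlinarith [hx.2]
  constructor
  · rw [← sub_nonneg]
    have : ((min ⌊((n : ℝ) + 1) * x⌋₊ n : ℕ) : ℝ) / (n + 1) - x - -(1 / ((n : ℝ) + 1)) =
      (((min ⌊((n : ℝ) + 1) * x⌋₊ n : ℕ) : ℝ) + 1 - ((n : ℝ) + 1) * x) / (n + 1) := by
      field_simp
      ring
    rw [this]
    exact div_nonneg (by linarith) hn.le
  · have : ((min ⌊((n : ℝ) + 1) * x⌋₊ n : ℕ) : ℝ) / (n + 1) ≤ x := by
      rw [div_le_iff₀ hn]; linarith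
    have : (0 : ℝ) ≤ 1 / (n + 1) := by positivity
    linarith

end unitInterval

/-! ### Approximation by positive matrices -/

open Filter Topology

namespace TournamentLimit

/-- The matrix of values of a tournament limit at the nodes of a uniform partition. -/
noncomputable def sample (W : TournamentLimit) (n : ℕ) : Matrix (Fin (n + 1)) (Fin (n + 1)) ℝ :=
  Matrix.of fun i j => W.toFun (unitInterval.node n i) (unitInterval.node n j)

theorem sample_mem_Icc (W : TournamentLimit) (n : ℕ) (i j : Fin (n + 1)) :
    W.sample n i j ∈ Set.Icc (0 : ℝ) 1 :=
  W.mem_Icc' _ _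

theorem tendsto_sum_sample (W : TournamentLimit)
    (hW : Continuous fun p : unitInterval × unitInterval => W.toFun p.1 p.2) (ℓ : ℕ) [NeZero ℓ] :
    Tendsto (fun n : ℕ => (∑ y : Fin ℓ → Fin (n + 1), ∏ i, W.sample n (y i) (y (i + 1))) /
      ((n : ℝ) + 1) ^ ℓ) atTop (𝓝 (W.cycleDensity ℓ)) := by
  simp only [← unitInterval.integral_comp_cell]
  refine tendsto_integral_of_dominated_convergence (fun _ => 1) (fun n => ?_)
    (integrable_const 1) (fun n => .of_forall fun x => ?_) (.of_forall fun x => ?_)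
  · have : Measurable fun (x : Fin ℓ → unitInterval) i => unitInterval.cell n (x i) :=
      measurable_pi_lambda _ fun i =>
        (unitInterval.measurable_cell n).comp (measurable_pi_apply i)
    exact ((measurable_of_finite fun y : Fin ℓ → Fin (n + 1) =>
      ∏ i, W.sample n (y i) (y (i + 1))).comp this).aestronglyMeasurable
  · rw [Real.norm_of_nonneg (Finset.prod_nonneg fun k _ => (W.sample_mem_Icc n _ _).1)]
    exact Finset.prod_le_one (fun k _ => (W.sample_mem_Icc n _ _).1)
      fun k _ => (W.sample_mem_Icc n _ _).2
  · refine tendsto_finsetProd _ fun i _ => ?_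
    exact (hW.tendsto (x i, x (i + 1))).comp ((unitInterval.tendsto_node_cell (x i)).prodMk_nhds
      (unitInterval.tendsto_node_cell (x (i + 1))))

theorem isPosTournament_sample {W : TournamentLimit} (hW : ∀ x y, 0 < W.toFun x y) (n : ℕ) :
    (W.sample n).IsPosTournament :=
  ⟨fun _ _ => hW _ _, fun _ _ => W.add_swap' _ _, n.succ_ne_zero⟩

/-- The pairs of densities of cycles of length three and four in positive tournament matrices. -/
def matrixProfile : Set (ℝ × ℝ) :=
  {p | ∃ (n : ℕ) (A : Matrix (Fin n) (Fin n) ℝ), A.IsPosTournament ∧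
    p = (A.walkDensity 3, A.walkDensity 4)}

theorem mem_closure_of_continuous {W : TournamentLimit}
    (hc : Continuous fun p : unitInterval × unitInterval => W.toFun p.1 p.2)
    (hpos : ∀ x y, 0 < W.toFun x y) :
    (W.cycleDensity 3, W.cycleDensity 4) ∈ closure matrixProfile := by
  refine mem_closure_of_tendsto
    ((W.tendsto_sum_sample hc 3).prodMk_nhds (W.tendsto_sum_sample hc 4)) (.of_forall fun n => ?_)
  refine ⟨n + 1, W.sample n, isPosTournament_sample hpos n, ?_⟩
  rw [Matrix.sum_cycle_three, Matrix.sum_cycle_four, Matrix.walkDensity, Matrix.walkDensity]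
  push_cast
  rfl

/-- The tournament limit obtained by moving `W` towards the constant `1 / 2`. -/
noncomputable def smooth (W : TournamentLimit) (ε : unitInterval) : TournamentLimit where
  toFun x y := (1 - (ε : ℝ)) * W.toFun x y + ε * (1 / 2)
  aemeasurable' := (W.aemeasurable'.const_mul _).add_const _
  mem_Icc' x y := by
    have h1 := ε.2.1
    have h2 := ε.2.2
    have h3 := W.apply_nonneg x y
    have h4 := W.apply_le_one x y
    constructor <;> nlinarith
  add_swap' x y := by
    have := W.add_swap' x y
    linear_combination (1 - (ε : ℝ)) * this

theorem abs_smooth_sub_le (W : TournamentLimit) (ε : unitInterval) (x y : unitInterval) :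
    |(W.smooth ε).toFun x y - W.toFun x y| ≤ ε := by
  have h1 := ε.2.1
  have h3 := W.apply_nonneg x y
  have h4 := W.apply_le_one x y
  have : (W.smooth ε).toFun x y - W.toFun x y = ε * (1 / 2 - W.toFun x y) := by
    simp only [smooth]
    ring
  rw [this, abs_mul, abs_of_nonneg h1]
  exact mul_le_of_le_one_right h1 (abs_le.2 ⟨by linarith, by linarith⟩)

theorem abs_cycleDensity_smooth_sub_le (W : TournamentLimit) (ε : unitInterval) {ℓ : ℕ} [NeZero ℓ]
    (hℓ : 2 ≤ ℓ) : |(W.smooth ε).cycleDensity ℓ - W.cycleDensity ℓ| ≤ ℓ * ε := by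
  refine ((W.smooth ε).abs_cycleDensity_sub_le W hℓ).trans ?_
  gcongr
  refine (integral_mono ((W.smooth ε).integrable_sub W).abs (integrable_const (ε : ℝ))
    fun p => W.abs_smooth_sub_le ε p.1 p.2).trans_eq ?_
  simp

/-- The continuous tournament limit obtained from a continuous kernel by truncation and
antisymmetrisation. -/
noncomputable def ofContinuous (h : unitInterval × unitInterval → ℝ) (hh : Continuous h) :
    TournamentLimit where
  toFun x y := ((Set.projIcc 0 1 zero_le_one (h (x, y)) : ℝ) + 1 -
    Set.projIcc 0 1 zero_le_one (h (y, x))) / 2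
  aemeasurable' := by
    refine Continuous.aemeasurable ?_
    fun_prop
  mem_Icc' x y := by
    have h1 := (Set.projIcc (0 : ℝ) 1 zero_le_one (h (x, y))).2
    have h2 := (Set.projIcc (0 : ℝ) 1 zero_le_one (h (y, x))).2
    constructor <;> linarith [h1.1, h1.2, h2.1, h2.2]
  add_swap' x y := by ring

theorem continuous_ofContinuous {h : unitInterval × unitInterval → ℝ} (hh : Continuous h) :
    Continuous fun p : unitInterval × unitInterval => (ofContinuous h hh).toFun p.1 p.2 := by
  simp only [ofContinuous]
  fun_prop

theorem abs_projIcc_sub_le {a b : ℝ} (ha : a ∈ Set.Icc (0 : ℝ) 1) :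
    |a - Set.projIcc (0 : ℝ) 1 zero_le_one b| ≤ |a - b| := by
  rw [Set.coe_projIcc]
  rcases le_total b 0 with h | h
  · rw [min_eq_right (by linarith), max_eq_left h, sub_zero, abs_of_nonneg ha.1]
    exact le_trans (by linarith) (le_abs_self _)
  · rcases le_total b 1 with h' | h'
    · rw [min_eq_right h', max_eq_right h]
    · rw [min_eq_left h', max_eq_right zero_le_one, abs_sub_comm, abs_of_nonneg (by linarith [ha.2]),
        abs_sub_comm]
      exact le_trans (by linarith) (le_abs_self _)

theorem integrable (W : TournamentLimit) :
    Integrable fun p : unitInterval × unitInterval => W.toFun p.1 p.2 := by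
  refine Integrable.of_bound (C := 1) W.aemeasurable'.aestronglyMeasurable
    (.of_forall fun p => ?_)
  rw [Real.norm_of_nonneg (W.apply_nonneg _ _)]
  exact W.apply_le_one _ _

/-- Clipping to [0,1] brings h no further from W, and antisymmetrising averages the error with its
reflection, which has the same integral. -/
theorem integral_abs_sub_ofContinuous_le (W : TournamentLimit)
    {h : unitInterval × unitInterval → ℝ} (hh : Continuous h) (hi : Integrable h) :
    ∫ p : unitInterval × unitInterval, |W.toFun p.1 p.2 - (ofContinuous h hh).toFun p.1 p.2| ≤
      ∫ p, |W.toFun p.1 p.2 - h p| := by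
  have hd : Integrable fun p : unitInterval × unitInterval => |W.toFun p.1 p.2 - h p| :=
    (W.integrable.sub hi).abs
  have hs : MeasurePreserving (Prod.swap : unitInterval × unitInterval → _) volume volume :=
    Measure.measurePreserving_swap
  have hds : Integrable fun p : unitInterval × unitInterval =>
      |W.toFun p.swap.1 p.swap.2 - h p.swap| := (hs.integrable_comp hd.aestronglyMeasurable).2 hd
  calc _ ≤ ∫ p : unitInterval × unitInterval, (|W.toFun p.1 p.2 - h p| / 2 +
        |W.toFun p.swap.1 p.swap.2 - h p.swap| / 2) := by
        refine integral_mono (W.integrable_sub _).abs ((hd.div_const 2).add (hds.div_const 2))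
          fun p => ?_
        have h1 := abs_projIcc_sub_le (b := h p) (W.mem_Icc' p.1 p.2)
        have h2 := abs_projIcc_sub_le (b := h p.swap) (W.mem_Icc' p.2 p.1)
        have h3 := W.add_swap' p.1 p.2
        have e : W.toFun p.1 p.2 - (ofContinuous h hh).toFun p.1 p.2 =
            (W.toFun p.1 p.2 - Set.projIcc (0 : ℝ) 1 zero_le_one (h p)) / 2 -
            (W.toFun p.2 p.1 - Set.projIcc (0 : ℝ) 1 zero_le_one (h p.swap)) / 2 := by
          simp only [ofContinuous, Prod.swap]
          linear_combination h3 / 2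
        simp only
        rw [e]
        refine (abs_sub _ _).trans ?_
        rw [abs_div, abs_div, abs_two]
        simp only [Prod.fst_swap, Prod.snd_swap]
        gcongr
    _ = (∫ p : unitInterval × unitInterval, |W.toFun p.1 p.2 - h p|) / 2 +
        (∫ p : unitInterval × unitInterval, |W.toFun p.swap.1 p.swap.2 - h p.swap|) / 2 := by
        rw [integral_add (hd.div_const 2) (hds.div_const 2), integral_div, integral_div]
    _ = _ := by
        have : ∫ p : unitInterval × unitInterval, |W.toFun p.swap.1 p.swap.2 - h p.swap| =
            ∫ p, |W.toFun p.1 p.2 - h p| :=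
          hs.integral_comp MeasurableEquiv.prodComm.measurableEmbedding
            fun p => |W.toFun p.1 p.2 - h p|
        rw [this, add_halves]

theorem mem_closure_matrixProfile (W : TournamentLimit) :
    (W.cycleDensity 3, W.cycleDensity 4) ∈ closure matrixProfile := by
  rw [← closure_closure, Metric.mem_closure_iff]
  intro δ hδ
  -- The continuous approximation and the smoothing each cost at most 4ε, as ℓ ≤ 4.
  obtain ⟨ε, hε0, hε1, hε⟩ : ∃ ε : ℝ, 0 < ε ∧ ε ≤ 1 ∧ 8 * ε < δ :=
    ⟨min 1 (δ / 9), by positivity, min_le_left _ _, by linarith [min_le_right 1 (δ / 9)]⟩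
  obtain ⟨h, hh, hhi⟩ := W.integrable.exists_boundedContinuous_integral_sub_le hε0
  let e : unitInterval := ⟨ε, hε0.le, hε1⟩
  let V := ofContinuous h h.continuous
  have hV := (W.integral_abs_sub_ofContinuous_le h.continuous hhi).trans hh
  have hclose : ∀ (ℓ : ℕ) [NeZero ℓ], 2 ≤ ℓ → ℓ ≤ 4 →
      |W.cycleDensity ℓ - (V.smooth e).cycleDensity ℓ| < δ := by
    intro ℓ _ h2 h4
    have h1 := W.abs_cycleDensity_sub_le V h2
    have h3 := V.abs_cycleDensity_smooth_sub_le e h2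
    have h4' : (ℓ : ℝ) ≤ 4 := by exact_mod_cast h4
    have h5 : (ℓ : ℝ) * ∫ p : unitInterval × unitInterval, |W.toFun p.1 p.2 - V.toFun p.1 p.2| ≤
        4 * ε := by gcongr
    have h6 : (ℓ : ℝ) * e ≤ 4 * ε := by gcongr
    rw [abs_sub_comm] at h3
    have := abs_sub_le (W.cycleDensity ℓ) (V.cycleDensity ℓ) ((V.smooth e).cycleDensity ℓ)
    linarith
  refine ⟨_, mem_closure_of_continuous (W := V.smooth e) ?_ ?_, ?_⟩
  · have := continuous_ofContinuous h.continuous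
    exact (continuous_const.mul this).add continuous_const
  · intro x y
    have h1 := V.apply_nonneg x y
    have : 0 ≤ (1 - ε) * V.toFun x y := mul_nonneg (by linarith) h1
    change 0 < (1 - ε) * V.toFun x y + ε * (1 / 2)
    linarith
  · rw [Prod.dist_eq, max_lt_iff]
    exact ⟨hclose 3 (by norm_num) (by norm_num), hclose 4 (by norm_num) le_rfl⟩

/-- Both orientations of a triangle have the same density. With W = 1/2 + U, their sum is 1/4 plus a
quadratic form in U, and smoothing scales U by 1 - ε. Hence smoothing strictly increases a density
below 1/8. -/
theorem cycleDensity_three_smooth (W : TournamentLimit) (ε : unitInterval) :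
    (W.smooth ε).cycleDensity 3 = 1 / 8 + (1 - (ε : ℝ)) ^ 2 * (W.cycleDensity 3 - 1 / 8) := by
  have key : ∀ V : TournamentLimit, 2 * V.cycleDensity 3 = ∫ x : Fin 3 → unitInterval,
      (∏ i, V.toFun (x i) (x (i + 1)) + ∏ i, V.toFun (x (i + 1)) (x i)) := by
    intro V
    have hrev : ∫ x : Fin 3 → unitInterval, ∏ i, V.toFun (x (i + 1)) (x i) = V.cycleDensity 3 := by
      have hp := volume_measurePreserving_piCongrLeft (fun _ : Fin 3 => unitInterval) Fin.revPerm
      rw [cycleDensity, ← hp.integral_comp']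
      refine integral_congr_ae (.of_forall fun x => ?_)
      have e : ∀ i, Equiv.piCongrLeft (fun _ : Fin 3 => unitInterval) Fin.revPerm x
          (Fin.revPerm i) = x i :=
        fun i => Equiv.piCongrLeft_apply_apply (fun _ : Fin 3 => unitInterval) Fin.revPerm x i
      have e0 : Equiv.piCongrLeft (fun _ : Fin 3 => unitInterval) Fin.revPerm x 2 = x 0 := e 0
      have e1 : Equiv.piCongrLeft (fun _ : Fin 3 => unitInterval) Fin.revPerm x 1 = x 1 := e 1
      have e2 : Equiv.piCongrLeft (fun _ : Fin 3 => unitInterval) Fin.revPerm x 0 = x 2 := e 2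
      simp only [Fin.prod_univ_three, MeasurableEquiv.coe_piCongrLeft, Fin.isValue, Fin.reduceAdd,
        zero_add, e0, e1, e2]
      ring
    rw [integral_add (V.integrable_prod _ (ne_add_one (by norm_num)))
      (V.integrable_prod _ fun k => (ne_add_one (by norm_num) k).symm), hrev, cycleDensity]
    ring
  have hint : Integrable fun x : Fin 3 → unitInterval =>
      ∏ i, W.toFun (x i) (x (i + 1)) + ∏ i, W.toFun (x (i + 1)) (x i) := (W.integrable_prod (ℓ := 3) Finset.univ (ne_add_one (by norm_num))).add
    (W.integrable_prod (ℓ := 3) Finset.univ fun k => (ne_add_one (by norm_num) k).symm)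
  have h := key (W.smooth ε)
  have hpt : ∀ x : Fin 3 → unitInterval, ∏ i, (W.smooth ε).toFun (x i) (x (i + 1)) +
      ∏ i, (W.smooth ε).toFun (x (i + 1)) (x i) =
      1 / 4 + (1 - (ε : ℝ)) ^ 2 * ((∏ i, W.toFun (x i) (x (i + 1)) +
        ∏ i, W.toFun (x (i + 1)) (x i)) - 1 / 4) := by
    intro x
    have hs : ∀ a b, W.toFun b a = 1 - W.toFun a b := fun a b => by linarith [W.add_swap' a b]
    simp only [Fin.prod_univ_three, smooth, hs (x _) (x (_ + 1))]
    ring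
  simp only [hpt] at h
  have hint' : Integrable fun x : Fin 3 → unitInterval => (1 - (ε : ℝ)) ^ 2 *
      ((∏ i, W.toFun (x i) (x (i + 1)) + ∏ i, W.toFun (x (i + 1)) (x i)) - 1 / 4) :=
    (hint.sub (integrable_const _)).const_mul _
  rw [integral_add (integrable_const _) hint',
    integral_const_mul, integral_sub hint (integrable_const _), ← key W] at h
  simp at h
  linarith

end TournamentLimit

/-! ### Transfer to limits and conclusion -/

namespace TournamentLimit

open PowerSum

theorem cycleDensity_three_le (W : TournamentLimit) : W.cycleDensity 3 ≤ 1 / 8 := by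
  have hcl : IsClosed {p : ℝ × ℝ | p.1 ≤ 1 / 8} := isClosed_le continuous_fst continuous_const
  refine closure_minimal ?_ hcl W.mem_closure_matrixProfile
  rintro _ ⟨n, A, hA, rfl⟩
  obtain ⟨R, hR, hk⟩ := hA.exists_spectrum
  have := hR.sum_re_cube_le_one
  rw [hk] at this
  change A.walkDensity 3 ≤ 1 / 8
  linarith

theorem two_part_bound (W : TournamentLimit) :
    2 * (8 * W.cycleDensity 3) ^ 2 + 8 * (8 * W.cycleDensity 3) ≤
      9 * (16 * W.cycleDensity 4) + 1 := by
  have hcl : IsClosed {p : ℝ × ℝ | 2 * (8 * p.1) ^ 2 + 8 * (8 * p.1) ≤ 9 * (16 * p.2) + 1} :=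
    isClosed_le (by fun_prop) (by fun_prop)
  refine closure_minimal ?_ hcl W.mem_closure_matrixProfile
  rintro _ ⟨n, A, hA, rfl⟩
  obtain ⟨R, hR, hk⟩ := hA.exists_spectrum
  have h0 := hA.walkDensity_three_nonneg
  have := hR.two_part_bound (by rw [hk]; positivity)
  rw [hk, hk] at this
  norm_num at this
  exact this

/-- The strict hypothesis is an open condition, so the approximating matrices can be taken to
satisfy it too. -/
theorem three_part_bound_of_lt (W : TournamentLimit) {z : ℝ} (hz : 1 / 3 ≤ z) (hz' : z ≤ 1 / 2)
    (h : cubeSum z < 8 * W.cycleDensity 3) : quarticSum z ≤ 16 * W.cycleDensity 4 := by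
  have ho : IsOpen {p : ℝ × ℝ | cubeSum z < 8 * p.1} :=
    isOpen_lt continuous_const (by fun_prop)
  have hcl : IsClosed {p : ℝ × ℝ | quarticSum z ≤ 16 * p.2} :=
    isClosed_le continuous_const (by fun_prop)
  have hm : (W.cycleDensity 3, W.cycleDensity 4) ∈
      closure ({p : ℝ × ℝ | cubeSum z < 8 * p.1} ∩ matrixProfile) :=
    ho.inter_closure ⟨h, W.mem_closure_matrixProfile⟩
  refine closure_minimal ?_ hcl hm
  rintro _ ⟨hlt, n, A, hA, rfl⟩
  obtain ⟨R, hR, hk⟩ := hA.exists_spectrum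
  have hlt : cubeSum z < 8 * A.walkDensity 3 := hlt
  have := hR.three_part_bound hz hz' (by rw [hk]; linarith)
  rw [hk] at this
  norm_num at this
  exact this

theorem three_part_bound (W : TournamentLimit) {z : ℝ} (hz : 1 / 3 ≤ z) (hz' : z ≤ 1 / 2)
    (h : cubeSum z = 8 * W.cycleDensity 3) : quarticSum z ≤ 16 * W.cycleDensity 4 := by
  have hle : 8 * W.cycleDensity 3 ≤ 1 / 4 := by
    rw [← h]
    refine (cubeSum_strictMonoOn.monotoneOn ⟨hz, hz'⟩ (by norm_num) hz').trans ?_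
    norm_num [cubeSum]
  refine le_of_forall_pos_le_add fun δ hδ => ?_
  -- Smoothing changes t(C_4) by at most 4ε, so 16 t(C_4) changes by at most 64ε ≤ δ.
  let ε : unitInterval := ⟨min 1 (δ / 64), le_min zero_le_one (by positivity), min_le_left _ _⟩
  have hε0 : 0 < (ε : ℝ) := lt_min one_pos (by positivity)
  have hε1 : (ε : ℝ) ≤ 1 := ε.2.2
  have hεδ : (ε : ℝ) ≤ δ / 64 := min_le_right _ _
  have h3 := W.cycleDensity_three_smooth ε
  have h4 := abs_le.1 (W.abs_cycleDensity_smooth_sub_le ε (ℓ := 4) (by norm_num))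
  have hpos : 0 < (ε : ℝ) * (2 - ε) * (1 / 8 - W.cycleDensity 3) :=
    mul_pos (mul_pos hε0 (by linarith)) (by linarith)
  have := (W.smooth ε).three_part_bound_of_lt hz hz' (by rw [h, h3]; linarith)
  push_cast at h4
  linarith [h4.2]

end TournamentLimit

theorem corollary4p7 (W : TournamentLimit) (hW : 1 / 72 ≤ W.cycleDensity 3) :
    W.cycleDensity 3 ≤ 1 / 8 ∧ g (W.cycleDensity 3) ≤ W.cycleDensity 4 := by
  have hle := W.cycleDensity_three_le
  refine ⟨hle, ?_⟩
  obtain ⟨z, hz, hzs⟩ := exists_blowupC3_eq (s := W.cycleDensity 3) ⟨by linarith, hle⟩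
  -- The threshold 1/72 is the value of `blowupC3` at 1/3.
  have hz3 : 1 / 3 ≤ z := by
    have h13 : (1 / 3 : ℝ) ∈ Set.Ioc (0 : ℝ) 1 := by norm_num
    rw [← blowupC3_strictMonoOn.le_iff_le h13 hz, hzs]
    norm_num [blowupC3]
    linarith
  rw [← hzs, g_blowupC3 hz]
  rcases lt_or_ge (1 / 2) z with h2 | h2
  · have hfl : ⌊z⁻¹⌋₊ = 1 := by
      rw [Nat.floor_eq_iff (inv_nonneg.2 hz.1.le)]
      refine ⟨by simpa using (one_le_inv₀ hz.1).2 hz.2, ?_⟩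
      rw [inv_lt_comm₀ hz.1 (by norm_num)]
      norm_num at h2 ⊢
      linarith
    -- The parts are z and 1 - z, an equality case of the two-part bound.
    have hb := W.two_part_bound
    rw [← hzs] at hb
    simp only [blowupC3, blowupC4, hfl, Nat.cast_one] at hb ⊢
    nlinarith
  · have key : blowupC3 z = 1 / 8 * PowerSum.cubeSum z ∧
        blowupC4 z = 1 / 16 * PowerSum.quarticSum z := by
      rcases hz3.eq_or_lt with rfl | h3
      -- At z = 1/3 the floor is 3, not 2, but the remainder is 0 and the parts are still z, z, 1 -
      -- 2z.
      · norm_num [blowupC3, blowupC4, PowerSum.cubeSum, PowerSum.quarticSum]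
      · have hfl : ⌊z⁻¹⌋₊ = 2 := by
          rw [Nat.floor_eq_iff (inv_nonneg.2 hz.1.le)]
          constructor
          · rw [le_inv_comm₀ (by norm_num) hz.1]
            norm_num at h2 ⊢
            linarith
          · rw [inv_lt_comm₀ hz.1 (by norm_num)]
            norm_num at h3 ⊢
            linarith
        simp [blowupC3, blowupC4, hfl, PowerSum.cubeSum, PowerSum.quarticSum]
    have := W.three_part_bound hz3 h2 (by linarith [key.1])
    linarith [key.2]
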